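/- Let $X$ be a nonempty compact metrizable space, with a fixed compatible metric $d$. Let $\mathrm{Iso}(X)$ be the set of isolated points of $X$, and let $X_1$ be the closure of the union of all connected components of $X$ which meet $\overline{\mathrm{Iso}(X)}$. A homeomorphism $f$ of $X$ is *chain transitive* if for all $x,y\in X$ and every $\varepsilon>0$ there are $n\ge 1$ and points $x=x_0,x_1,\dots,x_n=y$ of $X$ with $d(f(x_k),x_{k+1})\le\varepsilon$ for $0\le k<n$. The space $X$ is *$H(X)$-decomposable* if there is a proper, clopen, nonempty subset $A\subset X$ with $f(A)=A$ for every homeomorphism $f$ of $X$. A space is *zero-dimensional* if its clopen subsets form a base of its topology. 1. If $X_1$ is a proper, clopen, nonempty subset of $X$, then $X$ is $H(X)$-decomposable, and $X$ admits no chain transitive homeomorphism. 2. If $X_1$ is not a proper, clopen, nonempty subset of $X$, and the open set $X\setminus X_1$ is empty or zero-dimensional, then $X$ admits a chain transitive homeomorphism. 3. In particular, if the isolated points are dense in $X$, then $X$ admits a chain transitive homeomorphism. -/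

import Mathlib

open Set

/-- The set `Iso(X)` of isolated points of `X`. -/
def isolatedPoints (X : Type*) [TopologicalSpace X] : Set X :=
  {x | IsOpen ({x} : Set X)}

/-- The set `X₁`: the closure of the union of all connected components of `X` which meet the closure
of `Iso(X)`. A point lies in that union iff its own component meets the closure of `Iso(X)`. -/
def isolatedHull (X : Type*) [TopologicalSpace X] : Set X :=
  closure {x | (connectedComponent x ∩ closure (isolatedPoints X)).Nonempty}

/-- A proper, clopen, nonempty subset. -/
def ProperClopenNonempty {X : Type*} [TopologicalSpace X] (A : Set X) : Prop :=
  A ≠ univ ∧ IsClopen A ∧ A.Nonempty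

/-- `X` is `H(X)`-decomposable: some proper, clopen, nonempty subset is invariant under every
homeomorphism of `X`. -/
def HomeoDecomposable (X : Type*) [TopologicalSpace X] : Prop :=
  ∃ A : Set X, ProperClopenNonempty A ∧ ∀ f : X ≃ₜ X, f '' A = A

/-- `c 0, …, c n` is an `ε`-chain for `f` from `x` to `y`; it has at least two terms. -/
def IsEpsChain {X : Type*} [MetricSpace X] (f : X → X) (ε : ℝ) (x y : X) (n : ℕ) (c : ℕ → X) :
    Prop :=
  1 ≤ n ∧ c 0 = x ∧ c n = y ∧ ∀ k < n, dist (f (c k)) (c (k + 1)) ≤ ε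

/-- `f` is chain transitive: for every `ε > 0`, any point is connected to any point by a finite
`ε`-chain. -/
def ChainTransitive {X : Type*} [MetricSpace X] (f : X → X) : Prop :=
  ∀ x y : X, ∀ ε : ℝ, 0 < ε → ∃ (n : ℕ) (c : ℕ → X), IsEpsChain f ε x y n c

/-- `X` admits a chain transitive homeomorphism. -/
def AdmitsChainTransitiveHomeo (X : Type*) [MetricSpace X] : Prop :=
  ∃ f : X ≃ₜ X, ChainTransitive f

/-- A space is zero-dimensional if its clopen subsets form a base of the topology.
(The empty space satisfies this too.) -/
def ZeroDimensional (Y : Type*) [TopologicalSpace Y] : Prop :=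
  TopologicalSpace.IsTopologicalBasis {U : Set Y | IsClopen U}

open Filter Topology

/-! The set X₁ is defined topologically, so every homeomorphism preserves it, and a chain with small
enough jumps cannot leave an invariant clopen set. This is the obstruction.

For existence, the main case is that the set I of isolated points is not closed. Choose a dense
sequence `a` in closure(I) \ I and join each `a n` to its nearest predecessor; by compactness these
distances tend to 0. Hence I can be arranged in ℤ-orbits, one in each direction along every edge,
and the permutation extends by the identity to a homeomorphism (`exists_homeo_pieces_orbits`). The
tree of edges makes all `a n` chain equivalent, so closure(I) lies in one closed chain class. A
component meeting closure(I) is an isolated point or is fixed pointwise, and small jumps traverse a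
connected set of fixed points; thus X₁ lies in that class.

If X₁ is not all of X, it is not open. Its zero-dimensional perfect complement splits into Cantor
sets shrinking towards the boundary of X₁, and the same lemma puts them in orbits, each with both
ends at one boundary point (`exists_homeo_homoclinic_of_zeroDim_compl`). Every such orbit joins the
class.

Two cases remain: if X₁ is empty, a single point plays its role; if I is closed and X₁ nonempty, X
is finite and a cyclic permutation works. -/

/-! ### Asymptotic matching of two countable families -/

theorem exists_injective_forall_eventually_dist_lt {ι J X : Type*} [Countable ι] [Infinite ι]
    [Countable J] [Infinite J] [PseudoMetricSpace X] (p : ι → X) (q : J → X)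
    (hpq : ∀ i, ∀ ε > 0, {j | dist (p i) (q j) < ε}.Infinite) :
    ∃ φ : ι → J, Function.Injective φ ∧
      ∀ ε > 0, ∀ᶠ i in cofinite, dist (p i) (q (φ i)) < ε := by
  obtain ⟨e⟩ : Nonempty (ι ≃ ℕ) := nonempty_equiv_of_countable
  obtain ⟨e'⟩ : Nonempty (J ≃ ℕ) := nonempty_equiv_of_countable
  obtain ⟨φ, hφ, hd⟩ := extraction_forall_of_frequently
    (P := fun n m => dist (p (e.symm n)) (q (e'.symm m)) < 1 / ((n : ℝ) + 1)) (fun n => by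
      rw [Nat.frequently_atTop_iff_infinite]
      have := (hpq (e.symm n) (1 / ((n : ℝ) + 1)) (by positivity)).image e'.injective.injOn
      refine this.mono ?_
      rintro _ ⟨j, hj, rfl⟩
      simpa using hj)
  refine ⟨fun i => e'.symm (φ (e i)), e'.symm.injective.comp (hφ.injective.comp e.injective), ?_⟩
  intro ε hε
  have h1 : Tendsto (fun i => 1 / ((e i : ℝ) + 1)) cofinite (𝓝 0) :=
    tendsto_one_div_add_atTop_nhds_zero_nat.comp
      (Nat.cofinite_eq_atTop ▸ e.injective.tendsto_cofinite)
  filter_upwards [h1.eventually_lt_const hε] with i hi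
  have := hd (e i)
  simp only [Equiv.symm_apply_apply] at this
  exact this.trans hi

theorem exists_equiv_forall_eventually_dist_lt {ι J X : Type*} [Countable ι] [Infinite ι]
    [Countable J] [Infinite J] [PseudoMetricSpace X] (p : ι → X) (q : J → X)
    (hpq : ∀ i, ∀ ε > 0, {j | dist (p i) (q j) < ε}.Infinite)
    (hqp : ∀ j, ∀ ε > 0, {i | dist (p i) (q j) < ε}.Infinite) :
    ∃ h : ι ≃ J, ∀ ε > 0, ∀ᶠ i in cofinite, dist (p i) (q (h i)) < ε := by
  obtain ⟨φ, hφ, hφd⟩ := exists_injective_forall_eventually_dist_lt p q hpq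
  obtain ⟨ψ, hψ, hψd⟩ := exists_injective_forall_eventually_dist_lt q p
    (fun j ε hε => by simpa only [dist_comm] using hqp j ε hε)
  -- The relation records that each matched pair comes from `φ` or from `ψ`, so the bijection
  -- inherits both estimates.
  obtain ⟨h, hb, hR⟩ := Function.Embedding.schroeder_bernstein_of_rel hφ hψ
    (fun i j => j = φ i ∨ i = ψ j) (fun _ => Or.inl rfl) (fun _ => Or.inr rfl)
  refine ⟨Equiv.ofBijective h hb, fun ε hε => ?_⟩
  have h2 : ∀ᶠ i in cofinite, ∀ j, i = ψ j → dist (q j) (p (ψ j)) < ε := by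
    rw [eventually_cofinite]
    refine ((eventually_cofinite.1 (hψd ε hε)).image ψ).subset ?_
    intro i hi
    simp only [mem_ofPred_eq, not_forall] at hi
    obtain ⟨j, hij, hj⟩ := hi
    exact ⟨j, hj, hij.symm⟩
  filter_upwards [hφd ε hε, h2] with i h1 h2
  rcases hR i with h3 | h3
  · simpa [h3] using h1
  · have := h2 _ h3
    rw [← h3, dist_comm] at this
    exact this

/-! ### Homeomorphisms permuting small clopen pieces -/

section Pieces

variable {X ι M : Type*} [MetricSpace X] {Φ : ι → M → X}

/-- The points of the closure at distance at least `ε` from the remainder form a compact set covered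
by disjoint open pieces, so only finitely many pieces meet it. -/
theorem eventually_infDist_lt_of_pieces [CompactSpace X] (hopen : ∀ i, IsOpen (range (Φ i)))
    (hinj : ∀ i j m n, Φ i m = Φ j n → i = j ∧ m = n)
    (m₀ : M) {ε : ℝ}
    (hε : 0 < ε) : ∀ᶠ i in cofinite,
      Metric.infDist (Φ i m₀) (closure (⋃ i, range (Φ i)) \ ⋃ i, range (Φ i)) < ε := by
  set V := ⋃ i, range (Φ i) with hV
  have hC : IsCompact (closure V ∩ {x | ε ≤ Metric.infDist x (closure V \ V)}) :=
    (isClosed_closure.inter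
      (isClosed_le continuous_const (Metric.continuous_infDist_pt _))).isCompact
  obtain ⟨t, ht⟩ := hC.elim_finite_subcover (fun i => range (Φ i)) hopen (by
    rintro x ⟨hx, hx'⟩
    by_contra hxV
    have : Metric.infDist x (closure V \ V) = 0 := Metric.infDist_zero_of_mem ⟨hx, hxV⟩
    simp only [mem_ofPred_eq, this] at hx'
    linarith)
  rw [eventually_cofinite]
  refine t.finite_toSet.subset fun i hi => ?_
  have hi' : Φ i m₀ ∈ ⋃ i ∈ t, range (Φ i) :=
    ht ⟨subset_closure (mem_iUnion.2 ⟨i, m₀, rfl⟩), not_lt.1 hi⟩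
  simp only [mem_iUnion, mem_range] at hi'
  obtain ⟨j, hj, n, hn⟩ := hi'
  rw [(hinj _ _ _ _ hn).1] at hj
  exact hj

theorem exists_forall_eventually_dist_lt_of_pieces [CompactSpace X] [Nonempty M]
    (hopen : ∀ i, IsOpen (range (Φ i)))
    (hinj : ∀ i j m n, Φ i m = Φ j n → i = j ∧ m = n)
    (hdiam : ∀ ε > 0, ∀ᶠ i in cofinite, ∀ m n, dist (Φ i m) (Φ i n) < ε)
    (hne : (closure (⋃ i, range (Φ i)) \ ⋃ i, range (Φ i)).Nonempty) :
    ∃ p : ι → X, (∀ i, p i ∈ closure (⋃ i, range (Φ i)) \ ⋃ i, range (Φ i)) ∧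
      ∀ ε > 0, ∀ᶠ i in cofinite, ∀ m, dist (Φ i m) (p i) < ε := by
  obtain ⟨m₀⟩ := ‹Nonempty M›
  have hL : IsCompact (closure (⋃ i, range (Φ i)) \ ⋃ i, range (Φ i)) :=
    (isClosed_closure.sdiff (isOpen_iUnion hopen)).isCompact
  choose p hp hpd using fun i => hL.exists_infDist_eq_dist hne (Φ i m₀)
  refine ⟨p, hp, fun ε hε => ?_⟩
  filter_upwards [hdiam (ε / 2) (half_pos hε),
    eventually_infDist_lt_of_pieces hopen hinj m₀ (half_pos hε)] with i h1 h2 m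
  have := dist_triangle (Φ i m) (Φ i m₀) (p i)
  have := h1 m m₀
  have := hpd i
  linarith

/-- Otherwise these pieces and the finitely many pieces far from their `p i` have a closed union
missing `x`, yet pieces outside it come arbitrarily close to `x`. -/
theorem infinite_dist_lt_of_mem_closure_pieces [TopologicalSpace M] [CompactSpace M]
    (hcont : ∀ i, Continuous (Φ i)) {p : ι → X}
    (hp : ∀ ε > 0, ∀ᶠ i in cofinite, ∀ m, dist (Φ i m) (p i) < ε) {x : X}
    (hx : x ∈ closure (⋃ i, range (Φ i)) \ ⋃ i, range (Φ i)) {ε : ℝ} (hε : 0 < ε) :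
    {i | dist (p i) x < ε}.Infinite := by
  intro hS
  have hB := eventually_cofinite.1 (hp (ε / 2) (half_pos hε))
  have hcl : IsClosed (⋃ i ∈ {i | dist (p i) x < ε} ∪
      {i | ¬ ∀ m, dist (Φ i m) (p i) < ε / 2}, range (Φ i)) :=
    (hS.union hB).isClosed_biUnion fun i _ => (isCompact_range (hcont i)).isClosed
  have hxn : x ∈ (⋃ i ∈ {i | dist (p i) x < ε} ∪
      {i | ¬ ∀ m, dist (Φ i m) (p i) < ε / 2}, range (Φ i))ᶜ := by
    intro h
    obtain ⟨i, _, hi⟩ := mem_iUnion₂.1 h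
    exact hx.2 (mem_iUnion.2 ⟨i, hi⟩)
  obtain ⟨y, ⟨hy1, hy2⟩, hy3⟩ := mem_closure_iff.1 hx.1 _
    (hcl.isOpen_compl.inter Metric.isOpen_ball) ⟨hxn, Metric.mem_ball_self (half_pos hε)⟩
  obtain ⟨i, m, rfl⟩ := mem_iUnion.1 hy3
  have hi : i ∉ {i | dist (p i) x < ε} ∪ {i | ¬ ∀ m, dist (Φ i m) (p i) < ε / 2} :=
    fun h => hy1 (mem_iUnion₂.2 ⟨i, h, m, rfl⟩)
  simp only [mem_union, mem_ofPred_eq, not_or, not_not] at hi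
  refine hi.1 ?_
  have := dist_triangle (p i) (Φ i m) x
  have h2 := hi.2 m
  rw [dist_comm] at h2
  have := Metric.mem_ball.1 hy2
  linarith

/-- A permutation of the pieces which moves almost all of them by a small distance extends by the
identity to a homeomorphism. -/
theorem exists_homeo_permuting_pieces [CompactSpace X] [TopologicalSpace M] [CompactSpace M]
    (hcont : ∀ i, Continuous (Φ i))
    (hopen : ∀ i, IsOpen (range (Φ i))) (hinj : ∀ i j m n, Φ i m = Φ j n → i = j ∧ m = n)
    (g : Equiv.Perm ι)
    (hg : ∀ ε > 0, ∀ᶠ i in cofinite, ∀ m, dist (Φ i m) (Φ (g i) m) < ε) :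
    ∃ f : X ≃ₜ X, (∀ x ∉ ⋃ i, range (Φ i), f x = x) ∧ ∀ i m, f (Φ i m) = Φ (g i) m := by
  classical
  have hinj' : Function.Injective (fun a : ι × M => Φ a.1 a.2) := by
    rintro ⟨i, m⟩ ⟨j, n⟩ h
    obtain ⟨rfl, rfl⟩ := hinj _ _ _ _ h
    rfl
  let e : ι × M ≃ {x // x ∈ range (fun a : ι × M => Φ a.1 a.2)} := Equiv.ofInjective _ hinj'
  let F : Equiv.Perm X :=
    Equiv.Perm.extendDomain (Equiv.prodCongr g (Equiv.refl M) : Equiv.Perm (ι × M)) e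
  have hF1 : ∀ x ∉ ⋃ i, range (Φ i), F x = x := by
    intro x hx
    refine Equiv.Perm.extendDomain_apply_not_subtype _ _ ?_
    rintro ⟨⟨i, m⟩, rfl⟩
    exact hx (mem_iUnion.2 ⟨i, m, rfl⟩)
  have hF2 : ∀ i m, F (Φ i m) = Φ (g i) m := fun i m =>
    Equiv.Perm.extendDomain_apply_image (Equiv.prodCongr g (Equiv.refl M)) e (i, m)
  have hFc : Continuous F := by
    rw [continuous_iff_continuousAt]
    intro x
    by_cases hx : x ∈ ⋃ i, range (Φ i)
    · obtain ⟨i, m, rfl⟩ := mem_iUnion.1 hx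
      have hemb : IsOpenEmbedding (Φ i) :=
        ⟨((hcont i).isClosedEmbedding (fun m n h => (hinj _ _ _ _ h).2)).isEmbedding, hopen i⟩
      rw [← hemb.continuousAt_iff]
      have : F ∘ Φ i = Φ (g i) := funext fun m => hF2 i m
      rw [this]
      exact (hcont _).continuousAt
    -- Only finitely many pieces move by `ε / 2` or more; their union is closed and misses `x`.
    · rw [Metric.continuousAt_iff']
      intro ε hε
      have hB := eventually_cofinite.1 (hg (ε / 2) (half_pos hε))
      have hcl : IsClosed (⋃ i ∈ {i | ¬ ∀ m, dist (Φ i m) (Φ (g i) m) < ε / 2}, range (Φ i)) :=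
        hB.isClosed_biUnion fun i _ => (isCompact_range (hcont i)).isClosed
      have hxn : x ∈ (⋃ i ∈ {i | ¬ ∀ m, dist (Φ i m) (Φ (g i) m) < ε / 2}, range (Φ i))ᶜ := by
        intro h
        obtain ⟨i, _, hi⟩ := mem_iUnion₂.1 h
        exact hx (mem_iUnion.2 ⟨i, hi⟩)
      filter_upwards [hcl.isOpen_compl.mem_nhds hxn, Metric.ball_mem_nhds x (half_pos hε)]
        with y hy1 hy2
      rw [hF1 x hx]
      have hy3 : dist (F y) y < ε / 2 := by
        by_cases hy : y ∈ ⋃ i, range (Φ i)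
        · obtain ⟨i, m, rfl⟩ := mem_iUnion.1 hy
          rw [hF2, dist_comm]
          by_contra hcon
          exact hy1 (mem_iUnion₂.2 ⟨i, fun h => hcon (h m), m, rfl⟩)
        · rw [hF1 y hy, dist_self]
          exact half_pos hε
      have := dist_triangle (F y) y x
      have := Metric.mem_ball.1 hy2
      linarith
  exact ⟨hFc.homeoOfEquivCompactToT2, hF1, hF2⟩

/-- Pieces accumulating on `L` can be arranged in `ℤ`-orbits of a homeomorphism, each running
from a prescribed point of `L` to another. -/
theorem exists_homeo_pieces_orbits [CompactSpace X] [TopologicalSpace M] [CompactSpace M]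
    [Nonempty M] [Countable ι] {T : Type*} [Countable T]
    (hcont : ∀ i, Continuous (Φ i))
    (hopen : ∀ i, IsOpen (range (Φ i))) (hinj : ∀ i j m n, Φ i m = Φ j n → i = j ∧ m = n)
    (hdiam : ∀ ε > 0, ∀ᶠ i in cofinite, ∀ m n, dist (Φ i m) (Φ i n) < ε)
    (hne : (closure (⋃ i, range (Φ i)) \ ⋃ i, range (Φ i)).Nonempty) (u v : T → X)
    (hu : ∀ t, u t ∈ closure (⋃ i, range (Φ i)) \ ⋃ i, range (Φ i))
    (hv : ∀ t, v t ∈ closure (⋃ i, range (Φ i)) \ ⋃ i, range (Φ i))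
    (huv : ∀ ε > 0, ∀ᶠ t in cofinite, dist (u t) (v t) < ε)
    (hdense : closure (⋃ i, range (Φ i)) \ ⋃ i, range (Φ i) ⊆ closure (range u)) :
    ∃ (f : X ≃ₜ X) (z : T → M → ℤ → X), (∀ x ∉ ⋃ i, range (Φ i), f x = x) ∧
      (∀ t m k, f (z t m k) = z t m (k + 1)) ∧
      (∀ x, x ∈ (⋃ i, range (Φ i)) ↔ ∃ t m k, z t m k = x) ∧
      (∀ t m, Tendsto (z t m) atBot (𝓝 (u t))) ∧ (∀ t m, Tendsto (z t m) atTop (𝓝 (v t))) := by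
  obtain ⟨p, hpL, hp⟩ := exists_forall_eventually_dist_lt_of_pieces hopen hinj hdiam hne
  have hT : Nonempty T := by
    obtain ⟨x, hx⟩ := hne
    exact range_nonempty_iff_nonempty.1 (closure_nonempty_iff.1 ⟨x, hdense hx⟩)
  have hι : Infinite ι := by
    obtain ⟨x, hx⟩ := hne
    by_contra hfin
    rw [not_infinite_iff_finite] at hfin
    exact infinite_dist_lt_of_mem_closure_pieces hcont hp hx one_pos (toFinite _)
  -- The slot `(t, k)` should lie near `u t` for `k < 0` and near `v t` otherwise, so the shift
  -- changes the target only at `k = -1`.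
  let q : T × ℤ → X := fun a => if a.2 < 0 then u a.1 else v a.1
  have hqL : ∀ a, q a ∈ closure (⋃ i, range (Φ i)) \ ⋃ i, range (Φ i) := by
    intro a
    by_cases h : a.2 < 0
    · simpa only [q, if_pos h] using hu a.1
    · simpa only [q, if_neg h] using hv a.1
  obtain ⟨h, hh⟩ := exists_equiv_forall_eventually_dist_lt p q (by
      intro i ε hε
      obtain ⟨_, ⟨t, rfl⟩, ht⟩ := Metric.mem_closure_iff.1 (hdense (hpL i)) ε hε
      refine ((Set.Iio_infinite (0 : ℤ)).image (f := fun k => (t, k))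
        (fun a _ b _ hab => (Prod.mk.inj hab).2)).mono ?_
      rintro _ ⟨k, hk, rfl⟩
      simp only [mem_Iio] at hk
      simpa [q, hk] using ht)
    (fun j ε hε => infinite_dist_lt_of_mem_closure_pieces hcont hp (hqL j) hε)
  let s : Equiv.Perm (T × ℤ) := Equiv.prodCongr (Equiv.refl T) (Equiv.addRight (1 : ℤ))
  have hs : ∀ ε > 0, ∀ᶠ a in cofinite, dist (q a) (q (s a)) < ε := by
    intro ε hε
    rw [eventually_cofinite]
    refine ((eventually_cofinite.1 (huv ε hε)).image fun t => (t, (-1 : ℤ))).subset ?_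
    rintro ⟨t, k⟩ hk
    simp only [q, s, Equiv.prodCongr_apply, Prod.map, Equiv.refl_apply, Equiv.coe_addRight,
      mem_ofPred_eq] at hk
    rcases lt_trichotomy k (-1) with h1 | rfl | h1
    · rw [if_pos (by omega), if_pos (by omega), dist_self] at hk
      exact absurd hε hk
    · exact ⟨t, by simpa using hk, rfl⟩
    · rw [if_neg (by omega), if_neg (by omega), dist_self] at hk
      exact absurd hε hk
  let g : Equiv.Perm ι := (h.trans s).trans h.symm
  have hhg : ∀ i, h (g i) = s (h i) := fun i => by simp [g]
  obtain ⟨f, hf1, hf2⟩ := exists_homeo_permuting_pieces hcont hopen hinj g (by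
    intro ε hε
    have hε' : 0 < ε / 5 := by positivity
    filter_upwards [hp _ hε', g.injective.tendsto_cofinite.eventually (hp _ hε'), hh _ hε',
      g.injective.tendsto_cofinite.eventually (hh _ hε'),
      h.injective.tendsto_cofinite.eventually (hs _ hε')] with i h1 h2 h3 h4 h5 m
    have h1 := h1 m
    have h2 := h2 m
    rw [hhg] at h4
    rw [dist_comm] at h2 h4
    have e1 := dist_triangle (Φ i m) (p i) (Φ (g i) m)
    have e2 := dist_triangle (p i) (q (h i)) (Φ (g i) m)
    have e3 := dist_triangle (q (h i)) (q (s (h i))) (Φ (g i) m)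
    have e4 := dist_triangle (q (s (h i))) (p (g i)) (Φ (g i) m)
    linarith)
  have hlim : ∀ t m, ∀ ε > 0, ∀ᶠ k : ℤ in cofinite,
      dist (Φ (h.symm (t, k)) m) (q (t, k)) < ε := by
    intro t m ε hε
    have hi : Function.Injective fun k : ℤ => h.symm (t, k) :=
      h.symm.injective.comp (fun a b hab => (Prod.mk.inj hab).2)
    filter_upwards [hi.tendsto_cofinite.eventually (hp _ (half_pos hε)),
      hi.tendsto_cofinite.eventually (hh _ (half_pos hε))] with k h1 h2
    have h1 := h1 m
    rw [Equiv.apply_symm_apply] at h2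
    have := dist_triangle (Φ (h.symm (t, k)) m) (p (h.symm (t, k))) (q (t, k))
    linarith
  refine ⟨f, fun t m k => Φ (h.symm (t, k)) m, hf1, ?_, ?_, ?_, ?_⟩
  · intro t m k
    rw [hf2]
    simp [g, s]
  · intro x
    constructor
    · intro hx
      obtain ⟨i, m, rfl⟩ := mem_iUnion.1 hx
      exact ⟨(h i).1, m, (h i).2, by simp⟩
    · rintro ⟨t, m, k, rfl⟩
      exact mem_iUnion.2 ⟨_, m, rfl⟩
  · intro t m
    rw [Metric.tendsto_nhds]
    intro ε hε
    have hk := hlim t m ε hε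
    rw [Int.cofinite_eq, eventually_sup] at hk
    filter_upwards [hk.1, eventually_lt_atBot (0 : ℤ)] with k h1 h2
    simpa only [q, if_pos h2] using h1
  · intro t m
    rw [Metric.tendsto_nhds]
    intro ε hε
    have hk := hlim t m ε hε
    rw [Int.cofinite_eq, eventually_sup] at hk
    filter_upwards [hk.2, eventually_ge_atTop (0 : ℤ)] with k h1 h2
    simpa only [q, if_neg (not_lt.2 h2)] using h1

end Pieces

/-! ### Cantor sets -/

open TopologicalSpace in
/-- Brouwer's characterization of the Cantor space. -/
theorem nonempty_homeomorph_nat_bool (Y : Type*) [TopologicalSpace Y] [CompactSpace Y] [T2Space Y]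
    [SecondCountableTopology Y] [TotallyDisconnectedSpace Y] [Nonempty Y]
    (hperf : ∀ y : Y, ¬ IsOpen ({y} : Set Y)) : Nonempty (Y ≃ₜ (ℕ → Bool)) := by
  classical
  have : Countable (Clopens Y) := Clopens.countable_iff_secondCountable.2 inferInstance
  obtain ⟨B, hB⟩ := exists_surjective_nat (Clopens Y)
  -- Both halves are nonempty and neither is cut by `B n`. If `B n` does not cut `A`, any proper
  -- splitting will do, and one exists because `A` is not a singleton.
  have hsplit : ∀ (A : Clopens Y) (n : ℕ), ∃ S : Clopens Y, (A : Set Y).Nonempty →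
      ((A ⊓ S : Clopens Y) : Set Y).Nonempty ∧ ((A \ S : Clopens Y) : Set Y).Nonempty ∧
      (∀ x ∈ A ⊓ S, ∀ y ∈ A ⊓ S, x ∈ B n → y ∈ B n) ∧
      (∀ x ∈ A \ S, ∀ y ∈ A \ S, x ∈ B n → y ∈ B n) := by
    intro A n
    by_cases hA : (A : Set Y).Nonempty
    swap
    · exact ⟨⊤, fun h => absurd h hA⟩
    by_cases h1 : ((A ⊓ B n : Clopens Y) : Set Y).Nonempty ∧
        ((A \ B n : Clopens Y) : Set Y).Nonempty
    · exact ⟨B n, fun _ => ⟨h1.1, h1.2,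
        fun x _ y hy _ => hy.2, fun x hx _ _ hxB => absurd hxB hx.2⟩⟩
    · have hall : ∀ x ∈ A, ∀ y ∈ A, x ∈ B n → y ∈ B n := by
        intro x hx y hy hxB
        by_contra hyB
        exact h1 ⟨⟨x, hx, hxB⟩, ⟨y, hy, hyB⟩⟩
      obtain ⟨x, hx⟩ := hA
      obtain ⟨y, hy, hyx⟩ : ∃ y ∈ A, y ≠ x := by
        by_contra hcon
        push Not at hcon
        have : (A : Set Y) = {x} := Subset.antisymm hcon (singleton_subset_iff.2 hx)
        exact hperf x (this ▸ A.2.2)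
      obtain ⟨S, hS, hxS, hyS⟩ := exists_isClopen_of_totally_separated hyx
      exact ⟨⟨S, hS⟩, fun _ => ⟨⟨y, hy, hxS⟩, ⟨x, hx, hyS⟩,
        fun a ha b hb => hall a ha.1 b hb.1, fun a ha b hb => hall a ha.1 b hb.1⟩⟩
  choose σ hσ using hsplit
  let next : Clopens Y → ℕ → Bool → Clopens Y := fun A n b => if b then A ⊓ σ A n else A \ σ A n
  -- `P s n` is the level-`n` cell with address `s`; `Q y n` below is the level-`n` cell containing
  -- `y`, and `α y` is its address.
  obtain ⟨P, hP0, hPs⟩ : ∃ P : (ℕ → Bool) → ℕ → Clopens Y, (∀ s, P s 0 = ⊤) ∧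
      ∀ s n, P s (n + 1) = next (P s n) n (s n) :=
    ⟨fun s n => Nat.rec ⊤ (fun n A => next A n (s n)) n, fun _ => rfl, fun _ _ => rfl⟩
  obtain ⟨Q, hQ0, hQs'⟩ : ∃ Q : Y → ℕ → Clopens Y, (∀ y, Q y 0 = ⊤) ∧
      ∀ y n, Q y (n + 1) = next (Q y n) n (decide (y ∈ σ (Q y n) n)) :=
    ⟨fun y n => Nat.rec ⊤ (fun n A => next A n (decide (y ∈ σ A n))) n, fun _ => rfl,
      fun _ _ => rfl⟩
  let α : Y → ℕ → Bool := fun y n => decide (y ∈ σ (Q y n) n)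
  have hQs : ∀ y n, Q y (n + 1) = next (Q y n) n (α y n) := hQs'
  have hnext : ∀ A n b, next A n b ≤ A := by
    intro A n b
    cases b
    · exact sdiff_le
    · exact inf_le_left
  have hPne : ∀ (s : ℕ → Bool) (n : ℕ), (SetLike.coe (P s n)).Nonempty := by
    intro s n
    induction n with
    | zero => rw [hP0]; exact univ_nonempty
    | succ n ih =>
      rw [hPs]
      have := hσ (P s n) n ih
      cases s n
      · exact this.2.1
      · exact this.1
  have hmem : ∀ A n y, y ∈ A → ∀ b, y ∈ next A n b ↔ b = decide (y ∈ σ A n) := by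
    intro A n y hy b
    cases b
    · change (y ∈ A ∧ y ∉ σ A n) ↔ _
      simp [hy]
    · change (y ∈ A ∧ y ∈ σ A n) ↔ _
      simp [hy]
  have hyQ : ∀ y n, y ∈ Q y n := by
    intro y n
    induction n with
    | zero => rw [hQ0]; exact mem_univ y
    | succ n ih => rw [hQs]; exact (hmem _ _ _ ih _).2 rfl
  have hQP : ∀ y n, Q y n = P (α y) n := by
    intro y n
    induction n with
    | zero => rw [hQ0, hP0]
    | succ n ih => rw [hQs, hPs, ih]
  have hQsep : ∀ y n, ∀ a ∈ Q y (n + 1), ∀ b ∈ Q y (n + 1), a ∈ B n → b ∈ B n := by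
    intro y n
    rw [hQs]
    have := hσ (Q y n) n ⟨y, hyQ y n⟩
    cases α y n
    · exact this.2.2.2
    · exact this.2.2.1
  have hQconst : ∀ n y y', y' ∈ Q y n → Q y' n = Q y n := by
    intro n
    induction n with
    | zero => intros; rw [hQ0, hQ0]
    | succ n ih =>
      intro y y' h
      rw [hQs] at h
      have h1 := hnext _ _ _ h
      have h2 := ih y y' h1
      have h3 := (hmem _ _ _ h1 _).1 h
      rw [hQs, hQs, h2, h3]
      simp only [α, h2]
  have hα : Continuous α := by
    refine continuous_pi fun n => IsLocallyConstant.continuous ?_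
    rw [IsLocallyConstant.iff_eventually_eq]
    intro y
    filter_upwards [(Q y (n + 1)).2.2.mem_nhds (hyQ y (n + 1))] with y' hy'
    have h1 : y' ∈ next (Q y n) n (α y n) := hQs y n ▸ hy'
    have h2 := hnext _ _ _ h1
    rw [(hmem _ _ _ h2 _).1 h1]
    simp only [α, hQconst n y y' h2]
  have hinj : Function.Injective α := by
    intro x y hxy
    by_contra hne
    obtain ⟨S, hS, hxS, hyS⟩ := exists_isClopen_of_totally_separated hne
    obtain ⟨n, hn⟩ := hB ⟨S, hS⟩
    have hQ : Q x (n + 1) = Q y (n + 1) := by rw [hQP, hQP, hxy]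
    have := hQsep x n x (hyQ _ _) y (hQ ▸ hyQ _ _)
    rw [hn] at this
    exact hyS (this hxS)
  have hsurj : Function.Surjective α := by
    intro s
    obtain ⟨y, hy⟩ := IsCompact.nonempty_iInter_of_sequence_nonempty_isCompact_isClosed
      (fun n => SetLike.coe (P s n)) (fun n => hPs s n ▸ hnext _ _ _) (fun n => hPne s n)
      (P s 0).2.1.isCompact (fun n => (P s n).2.1)
    rw [mem_iInter] at hy
    have hPQ : ∀ n, Q y n = P s n := by
      intro n
      induction n with
      | zero => rw [hQ0, hP0]
      | succ n ih =>
        have h1 : y ∈ next (P s n) n (s n) := hPs s n ▸ hy (n + 1)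
        rw [hQs, hPs, (hmem _ _ _ (hy n) _).1 h1, ← ih]
    refine ⟨y, funext fun n => ?_⟩
    have h1 : y ∈ next (P s n) n (s n) := hPs s n ▸ hy (n + 1)
    rw [(hmem _ _ _ (hy n) _).1 h1, ← hPQ]
  exact ⟨Continuous.homeoOfEquivCompactToT2 (f := Equiv.ofBijective α ⟨hinj, hsurj⟩) hα⟩

/-! ### Homoclinic orbits on a zero-dimensional complement -/

theorem exists_seq_dense_in {X : Type*} [MetricSpace X] [CompactSpace X] {L : Set X}
    (hL : L.Nonempty) : ∃ a : ℕ → X, (∀ n, a n ∈ L) ∧ L ⊆ closure (range a) := by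
  have := hL.to_subtype
  refine ⟨fun n => (TopologicalSpace.denseSeq L n : X), fun n => Subtype.prop _, fun x hx => ?_⟩
  have h := TopologicalSpace.denseRange_denseSeq L ⟨x, hx⟩
  have := mem_closure_image (continuous_subtype_val.continuousAt (x := (⟨x, hx⟩ : L))) h
  rwa [← range_comp] at this

/-- The complement of a closed set, if zero-dimensional, is a disjoint union of clopen sets which
get small. -/
theorem exists_clopen_pieces {X : Type*} [MetricSpace X] [CompactSpace X] {F : Set X}
    (hF : IsClosed F) (hFo : ¬ IsOpen F)
    (hzd : ∀ x ∉ F, ∀ r > 0, ∃ W, IsClopen W ∧ x ∈ W ∧ W ⊆ Metric.ball x r) :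
    ∃ D : ℕ → Set X, (∀ k, IsClopen (D k)) ∧ Pairwise (Function.onFun Disjoint D) ∧
      ⋃ k, D k = Fᶜ ∧
      ∀ ε > 0, ∀ᶠ k in cofinite, ∀ x ∈ D k, ∀ y ∈ D k, dist x y < ε := by
  set U := Fᶜ with hU
  have hUo : IsOpen U := hF.isOpen_compl
  set L := closure U \ U with hLdef
  have hLc : IsClosed L := isClosed_closure.sdiff hUo
  have hLne : L.Nonempty := by
    rw [nonempty_iff_ne_empty, Ne, hLdef, sdiff_eq_empty]
    intro h
    exact hFo (isClosed_compl_iff.1 (closure_subset_iff_isClosed.1 h))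
  have hUne : U.Nonempty := by
    obtain ⟨x, hx⟩ := hLne
    exact closure_nonempty_iff.1 ⟨x, hx.1⟩
  -- A radius of half the distance to the boundary forces a piece of diameter at least `ε` to
  -- contain points at distance at least `ε / 2` from the boundary.
  have hW : ∀ x, ∃ W, x ∈ U → IsClopen W ∧ x ∈ W ∧ W ⊆ U ∧
      W ⊆ Metric.ball x (Metric.infDist x L / 2) := by
    intro x
    by_cases hx : x ∈ U
    swap
    · exact ⟨∅, fun h => absurd h hx⟩
    obtain ⟨r, hr, hrU⟩ := Metric.isOpen_iff.1 hUo x hx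
    have hpos : 0 < Metric.infDist x L :=
      (hLc.notMem_iff_infDist_pos hLne).1 fun h => h.2 hx
    obtain ⟨W, h1, h2, h3⟩ := hzd x hx (min r (Metric.infDist x L / 2))
      (lt_min hr (half_pos hpos))
    exact ⟨W, fun _ => ⟨h1, h2, h3.trans ((Metric.ball_subset_ball (min_le_left _ _)).trans hrU),
      h3.trans (Metric.ball_subset_ball (min_le_right _ _))⟩⟩
  choose W hW using hW
  obtain ⟨t, htU, htc, hcov⟩ := TopologicalSpace.countable_cover_nhdsWithin (f := W) (s := U)
    (fun x hx => mem_nhdsWithin_of_mem_nhds ((hW x hx).1.2.mem_nhds (hW x hx).2.1))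
  have htne : t.Nonempty := by
    obtain ⟨x, hx⟩ := hUne
    obtain ⟨y, hy, _⟩ := mem_iUnion₂.1 (hcov hx)
    exact ⟨y, hy⟩
  obtain ⟨c, rfl⟩ := htc.exists_eq_range htne
  have hcU : ∀ k, c k ∈ U := fun k => htU ⟨k, rfl⟩
  have hDsub : ∀ k, disjointed (fun k => W (c k)) k ⊆ W (c k) := disjointed_subset _
  have hcov' : ⋃ k, W (c k) = U := by
    refine Subset.antisymm (iUnion_subset fun k => (hW _ (hcU k)).2.2.1) ?_
    simpa using hcov
  refine ⟨disjointed (fun k => W (c k)), fun k => ?_, disjoint_disjointed _, ?_, ?_⟩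
  · exact disjointedRec (p := IsClopen) (fun t i ht => ht.diff (hW _ (hcU i)).1) (hW _ (hcU k)).1
  · rw [iUnion_disjointed, hcov']
  · intro ε hε
    have hC : IsCompact (closure U ∩ {x | ε / 2 ≤ Metric.infDist x L}) :=
      (isClosed_closure.inter
        (isClosed_le continuous_const (Metric.continuous_infDist_pt _))).isCompact
    obtain ⟨t, ht⟩ := hC.elim_finite_subcover (fun k => disjointed (fun k => W (c k)) k)
      (fun k => (disjointedRec (p := IsClopen) (fun t i ht => ht.diff (hW _ (hcU i)).1)
        (hW _ (hcU k)).1).2) (by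
        rintro x ⟨hx, hx'⟩
        rw [iUnion_disjointed, hcov']
        by_contra hxV
        have : Metric.infDist x L = 0 := Metric.infDist_zero_of_mem ⟨hx, hxV⟩
        simp only [mem_ofPred_eq, this] at hx'
        linarith)
    rw [eventually_cofinite]
    refine t.finite_toSet.subset fun k hk => ?_
    simp only [mem_ofPred_eq, not_forall, not_lt] at hk
    obtain ⟨x, hx, y, hy, hxy⟩ := hk
    have hx1 := Metric.mem_ball.1 ((hW _ (hcU k)).2.2.2 (hDsub k hx))
    have hy1 := Metric.mem_ball.1 ((hW _ (hcU k)).2.2.2 (hDsub k hy))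
    have h1 := dist_triangle_right x y (c k)
    have h2 := Metric.infDist_le_infDist_add_dist (s := L) (x := c k) (y := x)
    rw [dist_comm] at h2
    have hxC : x ∈ closure U ∩ {x | ε / 2 ≤ Metric.infDist x L} :=
      ⟨subset_closure ((hW _ (hcU k)).2.2.1 (hDsub k hx)), by
        simp only [mem_ofPred_eq]; linarith⟩
    obtain ⟨j, hj, hxj⟩ := mem_iUnion₂.1 (ht hxC)
    by_cases hjk : j = k
    · exact hjk ▸ hj
    · exact absurd hx (disjoint_left.1 (disjoint_disjointed _ hjk) hxj)

theorem exists_homeo_homoclinic_of_zeroDim_compl {X : Type*} [MetricSpace X] [CompactSpace X]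
    {F : Set X} (hF : IsClosed F) (hFo : ¬ IsOpen F) (hiso : ∀ x ∉ F, ¬ IsOpen ({x} : Set X))
    (hzd : ∀ x ∉ F, ∀ r > 0, ∃ W, IsClopen W ∧ x ∈ W ∧ W ⊆ Metric.ball x r) :
    ∃ f : X ≃ₜ X, (∀ x ∈ F, f x = x) ∧ ∀ x ∉ F, ∃ (z : ℤ → X) (y : X), (∃ k, z k = x) ∧
      (∀ k, z k ∉ F) ∧ (∀ k, f (z k) = z (k + 1)) ∧ y ∈ F ∧ y ∈ closure Fᶜ ∧
      Tendsto z atBot (𝓝 y) ∧ Tendsto z atTop (𝓝 y) := by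
  obtain ⟨D, hDc, hDd, hDU, hDs⟩ := exists_clopen_pieces hF hFo hzd
  have hDF : ∀ k, ∀ x ∈ D k, x ∉ F := fun k x hx => by
    have : x ∈ Fᶜ := hDU ▸ mem_iUnion.2 ⟨k, hx⟩
    exact this
  -- Pieces may be empty after disjointification; the nonempty ones are Cantor sets.
  have hhom : ∀ k : {k // (D k).Nonempty}, Nonempty (D k ≃ₜ (ℕ → Bool)) := by
    rintro ⟨k, hk⟩
    have : CompactSpace (D k) := isCompact_iff_compactSpace.1 (hDc k).1.isCompact
    have := hk.to_subtype
    have : TotallyDisconnectedSpace (D k) := by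
      rw [totallyDisconnectedSpace_subtype_iff]
      intro t htD ht x hx y hy
      by_contra hxy
      obtain ⟨W, hW, hxW, hWb⟩ := hzd x (hDF k x (htD hx)) (dist y x)
        (dist_pos.2 (Ne.symm hxy))
      have := hWb (ht.subset_isClopen hW ⟨x, hx, hxW⟩ hy)
      exact lt_irrefl _ (Metric.mem_ball.1 this)
    refine nonempty_homeomorph_nat_bool _ fun y hy => ?_
    have := (hDc k).2.isOpenMap_subtype_val _ hy
    rw [image_singleton] at this
    exact hiso _ (hDF k y y.2) this
  let e := fun k => (hhom k).some
  let Φ : {k // (D k).Nonempty} → (ℕ → Bool) → X := fun k m => ((e k).symm m : X)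
  have hrange : ∀ k, range (Φ k) = D k := by
    intro k
    change range (Subtype.val ∘ (e k).symm) = D k
    rw [range_comp, (e k).symm.surjective.range_eq, image_univ, Subtype.range_coe]
  have hV : ⋃ k, range (Φ k) = Fᶜ := by
    rw [← hDU]
    refine Subset.antisymm (iUnion_subset fun k => ?_) (iUnion_subset fun k x hx => ?_)
    · rw [hrange]
      exact subset_iUnion D k
    · exact mem_iUnion.2 ⟨⟨k, ⟨x, hx⟩⟩, by rw [hrange]; exact hx⟩
  have hne : (closure Fᶜ \ Fᶜ).Nonempty := by
    rw [nonempty_iff_ne_empty, Ne, sdiff_eq_empty]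
    intro h
    exact hFo (isClosed_compl_iff.1 (closure_subset_iff_isClosed.1 h))
  obtain ⟨a, haL, had⟩ := exists_seq_dense_in hne
  rw [← hV] at hne haL had
  obtain ⟨f, z, hf, hfz, hz, hbot, htop⟩ := exists_homeo_pieces_orbits (Φ := Φ)
    (fun k => continuous_subtype_val.comp (e k).symm.continuous)
    (fun k => by rw [hrange]; exact (hDc k).2)
    (by
      intro i j m n h
      have hij : i = j := by
        by_contra hij
        have h1 : Φ i m ∈ D i := ((e i).symm m).2
        have h2 : Φ j n ∈ D j := ((e j).symm n).2
        exact disjoint_left.1 (hDd fun h => hij (Subtype.ext h)) h1 (h ▸ h2)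
      subst hij
      exact ⟨rfl, (e i).symm.injective (Subtype.ext h)⟩)
    (fun ε hε => by
      filter_upwards [Subtype.val_injective.tendsto_cofinite.eventually (hDs ε hε)] with k hk m n
      exact hk _ ((e k).symm m).2 _ ((e k).symm n).2)
    hne a a haL haL (fun ε hε => by simp [hε]) had
  rw [hV] at hf haL
  simp only [hV] at hz
  refine ⟨f, fun x hx => hf x (fun h => h hx), fun x hx => ?_⟩
  obtain ⟨t, m, k, rfl⟩ := (hz x).1 hx
  exact ⟨z t m, a t, ⟨k, rfl⟩, fun k => (hz _).2 ⟨t, m, k, rfl⟩, hfz t m,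
    not_not.1 (haL t).2, (haL t).1, hbot t m, htop t m⟩

/-! ### Chain classes -/

section Chains

open Relation

variable {X : Type*} [MetricSpace X]

/-- One step of an `ε`-chain. -/
def ChainStep (f : X → X) (ε : ℝ) (x y : X) : Prop := dist (f x) y ≤ ε

/-- The points which are chain equivalent to `p`. -/
def chainClass (f : X → X) (p : X) : Set X :=
  {y | ∀ ε > 0, TransGen (ChainStep f ε) p y ∧ TransGen (ChainStep f ε) y p}

theorem exists_isEpsChain_of_transGen {f : X → X} {ε : ℝ} {x y : X}
    (h : TransGen (ChainStep f ε) x y) : ∃ n c, IsEpsChain f ε x y n c := by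
  induction h with
  | single h =>
    rename_i y
    refine ⟨1, fun k => if k = 0 then x else y, le_rfl, rfl, rfl, fun k hk => ?_⟩
    obtain rfl : k = 0 := by omega
    exact h
  | tail _ h ih =>
    rename_i _ z _
    obtain ⟨n, c, hn, h0, hy, hc⟩ := ih
    refine ⟨n + 1, fun k => if k ≤ n then c k else z, by omega, by simpa using h0, by simp,
      fun k hk => ?_⟩
    rcases Nat.lt_or_ge k n with hk' | hk'
    · simpa [hk'.le, Nat.succ_le_of_lt hk'] using hc k hk'
    · obtain rfl : k = n := by omega
      simpa [hy, ChainStep] using h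

theorem chainTransitive_of_chainClass_eq_univ {f : X → X} {p : X} (h : chainClass f p = univ) :
    ChainTransitive f := by
  intro x y ε hε
  have hx : x ∈ chainClass f p := h ▸ mem_univ x
  have hy : y ∈ chainClass f p := h ▸ mem_univ y
  exact exists_isEpsChain_of_transGen ((hx ε hε).2.trans (hy ε hε).1)

theorem ChainStep.mono {f : X → X} {ε ε' : ℝ} (h : ε ≤ ε') {x y : X} (hxy : ChainStep f ε x y) :
    ChainStep f ε' x y :=
  le_trans hxy h

theorem mem_chainClass_self {f : X → X} {p : X} (hp : f p = p) : p ∈ chainClass f p := by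
  intro ε hε
  have : TransGen (ChainStep f ε) p p := .single (by simp [ChainStep, hp, hε.le])
  exact ⟨this, this⟩

/-- The last jump into a nearby `y'` can be redirected to `y`, and by continuity of `f` the first
jump out of `y'` can start from `y`. -/
theorem isClosed_chainClass {f : X → X} (hf : Continuous f) (p : X) :
    IsClosed (chainClass f p) := by
  refine isClosed_of_closure_subset fun y hy ε hε => ?_
  obtain ⟨δ, hδ, hδf⟩ := Metric.continuous_iff.1 hf y (ε / 2) (half_pos hε)
  obtain ⟨y', hy', hyy'⟩ := Metric.mem_closure_iff.1 hy (min δ (ε / 2))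
    (lt_min hδ (half_pos hε))
  have h1 := hyy'.trans_le (min_le_left _ _)
  have h2 := hyy'.trans_le (min_le_right _ _)
  have hf' := hδf y' (by rwa [dist_comm])
  obtain ⟨hpy, hyp⟩ := hy' (ε / 2) (half_pos hε)
  have hmono : ∀ a b, ChainStep f (ε / 2) a b → ChainStep f ε a b :=
    fun a b h => h.mono (by linarith)
  constructor
  · obtain ⟨w, hw, hwy⟩ := TransGen.tail'_iff.1 hpy
    refine TransGen.tail' (ReflTransGen.mono hmono _ _ hw) ?_
    have := dist_triangle (f w) y' y
    rw [dist_comm y' y] at this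
    unfold ChainStep at hwy ⊢
    linarith
  · obtain ⟨w, hyw, hw⟩ := TransGen.head'_iff.1 hyp
    refine TransGen.head' ?_ (ReflTransGen.mono hmono _ _ hw)
    have := dist_triangle (f y) (f y') w
    rw [dist_comm] at hf'
    unfold ChainStep at hyw ⊢
    linarith

theorem transGen_of_orbit {f : X → X} {z : ℤ → X} (hz : ∀ k, f (z k) = z (k + 1)) {ε : ℝ}
    (hε : 0 < ε) {u v : X} (hu : f u = u) (hbot : Tendsto z atBot (𝓝 u))
    (htop : Tendsto z atTop (𝓝 v)) (k : ℤ) :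
    TransGen (ChainStep f ε) u (z k) ∧ TransGen (ChainStep f ε) (z k) v := by
  have hstep : ∀ k, ChainStep f ε (z k) (z (k + 1)) := fun k => by
    simp [ChainStep, hz, hε.le]
  have hmove : ∀ (k : ℤ) (n : ℕ), ReflTransGen (ChainStep f ε) (z k) (z (k + n)) := by
    intro k n
    induction n with
    | zero => simpa using ReflTransGen.refl
    | succ n ih =>
      refine ih.tail ?_
      push_cast
      rw [← add_assoc]
      exact hstep _
  constructor
  · obtain ⟨j, hj, hjk⟩ := ((Metric.tendsto_nhds.1 hbot ε hε).and (eventually_le_atBot k)).exists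
    obtain ⟨n, rfl⟩ := Int.le.dest hjk
    refine TransGen.head' ?_ (hmove j n)
    unfold ChainStep
    rw [hu, dist_comm]
    exact hj.le
  -- The jump to `v` leaves from `z (j - 1)`, whose image is `z j`; hence `j ≥ k + 1`.
  · obtain ⟨j, hj, hjk⟩ := ((Metric.tendsto_nhds.1 htop ε hε).and
      (eventually_ge_atTop (k + 1))).exists
    obtain ⟨n, hn⟩ := Int.le.dest (show k ≤ j - 1 by omega)
    refine TransGen.tail' (hmove k n) ?_
    unfold ChainStep
    rw [hz, hn, sub_add_cancel]
    exact hj.le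

theorem mem_chainClass_of_orbit {f : X → X} {z : ℤ → X} (hz : ∀ k, f (z k) = z (k + 1))
    {p u v : X} (hu : f u = u) (hbot : Tendsto z atBot (𝓝 u)) (htop : Tendsto z atTop (𝓝 v))
    (hup : u ∈ chainClass f p) (hvp : v ∈ chainClass f p) (k : ℤ) : z k ∈ chainClass f p :=
  fun ε hε => ⟨(hup ε hε).1.trans (transGen_of_orbit hz hε hu hbot htop k).1,
    (transGen_of_orbit hz hε hu hbot htop k).2.trans (hvp ε hε).2⟩

theorem mem_chainClass_of_isPreconnected {f : X → X} {C : Set X} (hC : IsPreconnected C)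
    (hfix : ∀ x ∈ C, f x = x) {p x y : X} (hx : x ∈ C) (hy : y ∈ C) (hxp : x ∈ chainClass f p) :
    y ∈ chainClass f p := by
  intro ε hε
  have key : ∀ {a b}, a ∈ C → b ∈ C → TransGen (ChainStep f ε) a b := by
    intro a b ha hb
    refine hC.induction₂' (TransGen (ChainStep f ε)) (fun a ha => ?_)
      (fun _ _ _ _ _ _ => TransGen.trans) ha hb
    filter_upwards [self_mem_nhdsWithin,
      mem_nhdsWithin_of_mem_nhds (Metric.ball_mem_nhds a hε)] with b hb hab
    have hab := (Metric.mem_ball.1 hab).le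
    refine ⟨.single ?_, .single ?_⟩
    · unfold ChainStep
      rwa [hfix a ha, dist_comm]
    · unfold ChainStep
      rwa [hfix b hb]
  exact ⟨(hxp ε hε).1.trans (key hx hy), (key hy hx).trans (hxp ε hε).2⟩

end Chains

/-! ### Invariance of the hull and the obstruction -/

theorem isOpen_isolatedPoints (X : Type*) [TopologicalSpace X] : IsOpen (isolatedPoints X) := by
  rw [← biUnion_of_singleton (isolatedPoints X)]
  exact isOpen_biUnion fun x hx => hx

theorem closure_isolatedPoints_subset_isolatedHull (X : Type*) [TopologicalSpace X] :
    closure (isolatedPoints X) ⊆ isolatedHull X :=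
  fun x hx => subset_closure ⟨x, mem_connectedComponent, hx⟩

theorem eq_of_mem_connectedComponent_of_isolated {X : Type*} [TopologicalSpace X] [T1Space X]
    {x j : X} (hj : j ∈ isolatedPoints X) (h : j ∈ connectedComponent x) : x = j :=
  isPreconnected_connectedComponent.subset_isClopen ⟨isClosed_singleton, hj⟩ ⟨j, h, rfl⟩
    mem_connectedComponent

theorem mapsTo_isolatedHull {X : Type*} [TopologicalSpace X] (f : X ≃ₜ X) :
    MapsTo f (isolatedHull X) (isolatedHull X) := by
  have hI : MapsTo f (isolatedPoints X) (isolatedPoints X) := fun x hx => by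
    have := f.isOpenMap _ hx
    rwa [image_singleton] at this
  refine MapsTo.closure (fun x hx => ?_) f.continuous
  obtain ⟨y, hy, hyI⟩ := hx
  exact ⟨f y, f.continuous.image_connectedComponent_subset x ⟨y, hy, rfl⟩,
    map_mem_closure f.continuous hyI hI⟩

theorem image_isolatedHull {X : Type*} [TopologicalSpace X] (f : X ≃ₜ X) :
    f '' isolatedHull X = isolatedHull X := by
  refine Subset.antisymm (mapsTo_isolatedHull f).image_subset fun x hx => ?_
  exact ⟨f.symm x, mapsTo_isolatedHull f.symm hx, f.apply_symm_apply x⟩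

theorem not_admitsChainTransitiveHomeo_of_homeoDecomposable {X : Type*} [MetricSpace X]
    [CompactSpace X] (h : HomeoDecomposable X) : ¬ AdmitsChainTransitiveHomeo X := by
  obtain ⟨A, ⟨hne, hA, x, hx⟩, hinv⟩ := h
  rintro ⟨f, hf⟩
  obtain ⟨y, hy⟩ := (ne_univ_iff_exists_notMem A).1 hne
  -- A compact open set contains a thickening of itself, so jumps of size `δ / 2` stay inside.
  obtain ⟨δ, hδ, hδA⟩ := hA.1.isCompact.exists_thickening_subset_open hA.2 Subset.rfl
  obtain ⟨n, c, -, h0, hn, hc⟩ := hf x y (δ / 2) (half_pos hδ)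
  have key : ∀ k ≤ n, c k ∈ A := by
    intro k
    induction k with
    | zero => intro _; rwa [h0]
    | succ k ih =>
      intro hk
      refine hδA (Metric.mem_thickening_iff.2 ⟨f (c k), ?_, ?_⟩)
      · exact hinv f ▸ mem_image_of_mem f (ih (by omega))
      · rw [dist_comm]
        have := hc k (by omega)
        linarith
  exact hy (hn ▸ key n le_rfl)

theorem exists_isClopen_subset_ball {X : Type*} [MetricSpace X] {U : Set X} (hU : IsOpen U)
    (hz : ZeroDimensional U) {x : X} (hx : x ∈ U) {r : ℝ} (hr : 0 < r) :
    ∃ W, IsClopen W ∧ x ∈ W ∧ W ⊆ Metric.ball x r := by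
  -- Staying in a closed ball inside `U` makes a relatively closed set closed in `X`.
  obtain ⟨s, hs, hsU⟩ := Metric.nhds_basis_closedBall.mem_iff.1 (hU.mem_nhds hx)
  obtain ⟨V, hV, hxV, hVs⟩ := hz.exists_subset_of_mem_open
    (a := ⟨x, hx⟩) (u := Subtype.val ⁻¹' Metric.ball x (min r s))
    (Metric.mem_ball_self (lt_min hr hs)) (Metric.isOpen_ball.preimage continuous_subtype_val)
  obtain ⟨C, hC, rfl⟩ := isClosed_induced_iff.1 hV.1
  refine ⟨Subtype.val '' (Subtype.val ⁻¹' C : Set U), ⟨?_, hU.isOpenMap_subtype_val _ hV.2⟩,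
    ⟨_, hxV, rfl⟩, ?_⟩
  · have : Subtype.val '' (Subtype.val ⁻¹' C : Set U) = C ∩ Metric.closedBall x s := by
      ext y
      constructor
      · rintro ⟨w, hw, rfl⟩
        exact ⟨hw, Metric.ball_subset_closedBall
          (Metric.ball_subset_ball (min_le_right _ _) (hVs hw))⟩
      · rintro ⟨h1, h2⟩
        exact ⟨⟨y, hsU h2⟩, h1, rfl⟩
    rw [this]
    exact hC.inter Metric.isClosed_closedBall
  · rintro _ ⟨w, hw, rfl⟩
    exact Metric.ball_subset_ball (min_le_left _ _) (hVs hw)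

/-! ### Orbits of isolated points -/

/-- Terms whose nearest predecessor is at distance at least `ε` are `ε`-separated, so compactness
allows only finitely many. -/
theorem exists_nearest_predecessor {X : Type*} [MetricSpace X] [CompactSpace X] (a : ℕ → X) :
    ∃ b : ℕ → ℕ, (∀ n, n ≠ 0 → b n < n) ∧
      ∀ ε > 0, ∀ᶠ n in cofinite, dist (a n) (a (b n)) < ε := by
  have h : ∀ n, ∃ m, (n ≠ 0 → m < n) ∧ ∀ k < n, dist (a n) (a m) ≤ dist (a n) (a k) := by
    intro n
    rcases eq_or_ne n 0 with rfl | hn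
    · exact ⟨0, by simp⟩
    · obtain ⟨m, hm, hmin⟩ := Finset.exists_min_image (Finset.range n)
        (fun k => dist (a n) (a k)) ⟨0, Finset.mem_range.2 (Nat.pos_of_ne_zero hn)⟩
      exact ⟨m, fun _ => Finset.mem_range.1 hm, fun k hk => hmin k (Finset.mem_range.2 hk)⟩
  choose b hb hmin using h
  refine ⟨b, hb, fun ε hε => ?_⟩
  rw [Nat.cofinite_eq_atTop]
  by_contra hcon
  obtain ⟨φ, hφ, hd⟩ := extraction_of_frequently_atTop (not_eventually.1 hcon)
  obtain ⟨x, ψ, hψ, hx⟩ := CompactSpace.tendsto_subseq (fun n => a (φ n))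
  obtain ⟨N, hN⟩ := Metric.tendsto_atTop.1 hx (ε / 2) (half_pos hε)
  have h1 := hN N le_rfl
  have h2 := hN (N + 1) (Nat.le_succ N)
  have h3 := hmin (φ (ψ (N + 1))) (φ (ψ N)) (hφ (hψ (Nat.lt_succ_self N)))
  have h4 := hd (ψ (N + 1))
  have h5 := dist_triangle_right (a (φ (ψ (N + 1)))) (a (φ (ψ N))) x
  simp only [Function.comp] at h1 h2
  linarith

/-- If the isolated points do not form a closed set, then some homeomorphism, the identity on the
other points, arranges them in orbits joining the points of a dense sequence of the remainder. -/
theorem exists_homeo_isolatedPoints_orbits {X : Type*} [MetricSpace X] [CompactSpace X]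
    (hI : ¬ IsClosed (isolatedPoints X)) :
    ∃ (f : X ≃ₜ X) (a : ℕ → X) (b : ℕ → ℕ) (z : ℕ × Bool → ℤ → X),
      (∀ x ∉ isolatedPoints X, f x = x) ∧
      (∀ n, a n ∈ closure (isolatedPoints X) \ isolatedPoints X) ∧
      closure (isolatedPoints X) \ isolatedPoints X ⊆ closure (range a) ∧
      (∀ n, n ≠ 0 → b n < n) ∧ (∀ t k, f (z t k) = z t (k + 1)) ∧
      (∀ x, x ∈ isolatedPoints X ↔ ∃ t k, z t k = x) ∧
      ∀ n, Tendsto (z (n, true)) atBot (𝓝 (a n)) ∧ Tendsto (z (n, true)) atTop (𝓝 (a (b n))) ∧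
        Tendsto (z (n, false)) atBot (𝓝 (a (b n))) ∧ Tendsto (z (n, false)) atTop (𝓝 (a n)) := by
  let Φ : isolatedPoints X → Unit → X := fun i _ => i
  have hrange : ∀ i, range (Φ i) = {(i : X)} := fun i => range_const
  have hV : ⋃ i, range (Φ i) = isolatedPoints X := by
    ext x
    simp [hrange]
  have hne : (closure (isolatedPoints X) \ isolatedPoints X).Nonempty := by
    rw [nonempty_iff_ne_empty, Ne, sdiff_eq_empty]
    exact fun h => hI (closure_subset_iff_isClosed.1 h)
  obtain ⟨a, haL, had⟩ := exists_seq_dense_in hne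
  obtain ⟨b, hb, hbd⟩ := exists_nearest_predecessor a
  have : Countable (isolatedPoints X) := by
    have : DiscreteTopology (isolatedPoints X) := by
      refine discreteTopology_iff_isOpen_singleton.2 fun i => ?_
      have := i.2.preimage (continuous_subtype_val (p := (· ∈ isolatedPoints X)))
      rwa [show (Subtype.val ⁻¹' {(i : X)} : Set (isolatedPoints X)) = {i} by
        ext j; simp [Subtype.ext_iff]] at this
    exact TopologicalSpace.separableSpace_iff_countable.1 inferInstance
  -- The Boolean orients the edge between `a n` and `a (b n)`; both directions are needed for chain
  -- equivalence.
  let u : ℕ × Bool → X := fun t => if t.2 then a t.1 else a (b t.1)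
  let v : ℕ × Bool → X := fun t => if t.2 then a (b t.1) else a t.1
  have huL : ∀ t, u t ∈ closure (isolatedPoints X) \ isolatedPoints X := by
    rintro ⟨n, _ | _⟩
    · exact haL (b n)
    · exact haL n
  have hvL : ∀ t, v t ∈ closure (isolatedPoints X) \ isolatedPoints X := by
    rintro ⟨n, _ | _⟩
    · exact haL n
    · exact haL (b n)
  have hud : closure (isolatedPoints X) \ isolatedPoints X ⊆ closure (range u) := by
    refine had.trans (closure_mono ?_)
    rintro _ ⟨n, rfl⟩
    exact ⟨(n, true), rfl⟩
  have huv : ∀ ε > 0, ∀ᶠ t in cofinite, dist (u t) (v t) < ε := by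
    intro ε hε
    rw [eventually_cofinite]
    refine ((eventually_cofinite.1 (hbd ε hε)).prod (finite_univ (α := Bool))).subset ?_
    rintro ⟨n, _ | _⟩ ht
    · refine ⟨?_, mem_univ _⟩
      rw [mem_ofPred_eq, dist_comm] at ht
      exact ht
    · exact ⟨ht, mem_univ _⟩
  rw [← hV] at hne huL hvL hud
  obtain ⟨f, z, hf, hfz, hz, hbot, htop⟩ := exists_homeo_pieces_orbits (Φ := Φ)
    (fun _ => continuous_const) (fun i => by rw [hrange]; exact i.2)
    (fun i j _ _ h => ⟨Subtype.ext h, rfl⟩)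
    (fun ε hε => by simp [Φ, hε]) hne u v huL hvL huv hud
  rw [hV] at hf
  simp only [hV] at hz
  refine ⟨f, a, b, fun t => z t (), hf, haL, had, hb, fun t => hfz t (), fun x => ?_, fun n => ?_⟩
  · rw [hz]
    exact ⟨fun ⟨t, _, k, h⟩ => ⟨t, k, h⟩, fun ⟨t, k, h⟩ => ⟨t, (), k, h⟩⟩
  · exact ⟨hbot (n, true) (), htop (n, true) (), hbot (n, false) (), htop (n, false) ()⟩

/-! ### Existence of chain transitive homeomorphisms -/

theorem admitsChainTransitiveHomeo_of_discrete (X : Type*) [MetricSpace X] [Finite X]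
    [DiscreteTopology X] : AdmitsChainTransitiveHomeo X := by
  classical
  cases nonempty_fintype X
  obtain ⟨g, hg, -⟩ := (Finset.univ : Finset X).exists_cycleOn
  let f : X ≃ₜ X := ⟨g, continuous_of_discreteTopology, continuous_of_discreteTopology⟩
  refine ⟨f, fun x y ε hε => ?_⟩
  -- Starting the power from `g x` keeps the chain nontrivial when `x = y`.
  obtain ⟨n, -, hn⟩ := hg.exists_pow_eq (Finset.mem_univ (g x)) (Finset.mem_univ y)
  refine ⟨n + 1, fun k => (g ^ k) x, by omega, rfl, ?_, fun k _ => ?_⟩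
  · change (g ^ (n + 1)) x = y
    rw [pow_succ]
    exact hn
  · have : f ((g ^ k) x) = (g ^ (k + 1)) x := by
      rw [pow_succ']
      rfl
    rw [this, dist_self]
    exact hε.le

theorem admitsChainTransitiveHomeo_of_zeroDim_perfect (X : Type*) [MetricSpace X]
    [CompactSpace X] [Nonempty X] (hiso : isolatedPoints X = ∅)
    (hzd : ∀ x : X, ∀ r > 0, ∃ W, IsClopen W ∧ x ∈ W ∧ W ⊆ Metric.ball x r) :
    AdmitsChainTransitiveHomeo X := by
  obtain ⟨p⟩ := ‹Nonempty X›
  have hno : ∀ x : X, ¬ IsOpen ({x} : Set X) := fun x hx => by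
    have : x ∈ isolatedPoints X := hx
    rw [hiso] at this
    exact this
  obtain ⟨f, hfp, hf⟩ := exists_homeo_homoclinic_of_zeroDim_compl (isClosed_singleton (x := p))
    (hno p) (fun x _ => hno x) (fun x _ => hzd x)
  have hp : f p = p := hfp p rfl
  refine ⟨f, chainTransitive_of_chainClass_eq_univ (p := p) (eq_univ_of_forall fun x => ?_)⟩
  by_cases hx : x ∈ ({p} : Set X)
  · rw [mem_singleton_iff.1 hx]
    exact mem_chainClass_self hp
  · obtain ⟨z, y, ⟨k, rfl⟩, -, hz, hy, -, hbot, htop⟩ := hf x hx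
    rw [mem_singleton_iff.1 hy] at hbot htop
    exact mem_chainClass_of_orbit hz hp hbot htop (mem_chainClass_self hp)
      (mem_chainClass_self hp) k

theorem isolatedHull_eq_of_isClosed {X : Type*} [TopologicalSpace X] [T1Space X]
    (h : IsClosed (isolatedPoints X)) : isolatedHull X = isolatedPoints X := by
  refine Subset.antisymm (closure_minimal ?_ h)
    (subset_closure.trans (closure_isolatedPoints_subset_isolatedHull X))
  rintro x ⟨j, hjx, hj⟩
  rw [h.closure_eq] at hj
  rwa [eq_of_mem_connectedComponent_of_isolated hj hjx]

theorem admitsChainTransitiveHomeo_of_not_isClosed_isolatedPoints {X : Type*} [MetricSpace X]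
    [CompactSpace X] (hI : ¬ IsClosed (isolatedPoints X))
    (hF : IsOpen (isolatedHull X) → isolatedHull X = univ)
    (hzd : ∀ x ∉ isolatedHull X, ∀ r > 0, ∃ W, IsClopen W ∧ x ∈ W ∧ W ⊆ Metric.ball x r) :
    AdmitsChainTransitiveHomeo X := by
  have hIF : isolatedPoints X ⊆ isolatedHull X :=
    subset_closure.trans (closure_isolatedPoints_subset_isolatedHull X)
  obtain ⟨f₁, a, b, z, hid, haL, had, hb, hfz, hz, hlim⟩ := exists_homeo_isolatedPoints_orbits hI
  obtain ⟨f₂, hf₂F, hf₂⟩ : ∃ f : X ≃ₜ X, (∀ x ∈ isolatedHull X, f x = x) ∧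
      ∀ x ∉ isolatedHull X, ∃ (z : ℤ → X) (y : X), (∃ k, z k = x) ∧
      (∀ k, z k ∉ isolatedHull X) ∧ (∀ k, f (z k) = z (k + 1)) ∧ y ∈ isolatedHull X ∧
      y ∈ closure (isolatedHull X)ᶜ ∧ Tendsto z atBot (𝓝 y) ∧ Tendsto z atTop (𝓝 y) := by
    by_cases hFo : IsOpen (isolatedHull X)
    · exact ⟨Homeomorph.refl X, fun _ _ => rfl, fun x hx => absurd (hF hFo ▸ mem_univ x) hx⟩
    · exact exists_homeo_homoclinic_of_zeroDim_compl isClosed_closure hFo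
        (fun x hx hxo => hx (hIF hxo)) hzd
  -- The supports are disjoint: `f₁` moves only isolated points and `f₂` only points off the hull.
  let f : X ≃ₜ X := f₂.trans f₁
  have hfix : ∀ x ∈ isolatedHull X, x ∉ isolatedPoints X → f x = x := by
    intro x hx hxI
    change f₁ (f₂ x) = x
    rw [hf₂F x hx, hid x hxI]
  have haF : ∀ n, a n ∈ isolatedHull X := fun n =>
    closure_isolatedPoints_subset_isolatedHull X (haL n).1
  have hafix : ∀ n, f (a n) = a n := fun n => hfix _ (haF n) (haL n).2
  have hzI : ∀ t k, z t k ∈ isolatedPoints X := fun t k => (hz _).2 ⟨t, k, rfl⟩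
  have hzf : ∀ t k, f (z t k) = z t (k + 1) := by
    intro t k
    change f₁ (f₂ (z t k)) = _
    rw [hf₂F _ (hIF (hzI t k)), hfz]
  have hcl := isClosed_chainClass f.continuous (a 0)
  have ha : ∀ n, a n ∈ chainClass f (a 0) := by
    intro n
    induction n using Nat.strong_induction_on with
    | _ n ih =>
      rcases eq_or_ne n 0 with rfl | hn
      · exact mem_chainClass_self (hafix 0)
      · intro ε hε
        have h := ih (b n) (hb n hn) ε hε
        obtain ⟨l1, l2, l3, l4⟩ := hlim n
        have h1 := transGen_of_orbit (hzf (n, true)) hε (hafix n) l1 l2 0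
        have h2 := transGen_of_orbit (hzf (n, false)) hε (hafix (b n)) l3 l4 0
        exact ⟨h.1.trans (h2.1.trans h2.2), (h1.1.trans h1.2).trans h.2⟩
  have hI' : ∀ x ∈ isolatedPoints X, x ∈ chainClass f (a 0) := by
    intro x hx
    obtain ⟨⟨n, s⟩, k, rfl⟩ := (hz x).1 hx
    obtain ⟨l1, l2, l3, l4⟩ := hlim n
    cases s
    · exact mem_chainClass_of_orbit (hzf _) (hafix _) l3 l4 (ha _) (ha _) k
    · exact mem_chainClass_of_orbit (hzf _) (hafix _) l1 l2 (ha _) (ha _) k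
  have hcI : closure (isolatedPoints X) ⊆ chainClass f (a 0) := closure_minimal hI' hcl
  have hF' : isolatedHull X ⊆ chainClass f (a 0) := by
    refine closure_minimal ?_ hcl
    intro x hx
    by_cases hxI : x ∈ isolatedPoints X
    · exact hI' x hxI
    obtain ⟨y, hyx, hyI⟩ := id hx
    refine mem_chainClass_of_isPreconnected (isPreconnected_connectedComponent (x := x))
      (fun w hw => hfix w ?_ ?_) hyx mem_connectedComponent (hcI hyI)
    · refine subset_closure ⟨y, ?_, hyI⟩
      rwa [← connectedComponent_eq hw]
    · intro hwI
      exact hxI (eq_of_mem_connectedComponent_of_isolated hwI hw ▸ hwI)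
  refine ⟨f, chainTransitive_of_chainClass_eq_univ (p := a 0) (eq_univ_of_forall fun x => ?_)⟩
  by_cases hx : x ∈ isolatedHull X
  · exact hF' hx
  obtain ⟨w, y, ⟨k, rfl⟩, hwF, hw, hyF, hyc, hbot, htop⟩ := hf₂ x hx
  -- A limit of points off the hull is not isolated, so `f` fixes `y`.
  have hyI : y ∉ isolatedPoints X := by
    intro hyI
    obtain ⟨x', hx', hx''⟩ := mem_closure_iff.1 hyc _ (isOpen_isolatedPoints X) hyI
    exact hx'' (hIF hx')
  refine mem_chainClass_of_orbit (fun k => ?_) (hfix y hyF hyI) hbot htop (hF' hyF) (hF' hyF) k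
  change f₁ (f₂ (w k)) = _
  rw [hw, hid _ fun h => hwF _ (hIF h)]

theorem admitsChainTransitiveHomeo_of_not_properClopenNonempty {X : Type*} [MetricSpace X]
    [CompactSpace X] [Nonempty X] (h : ¬ ProperClopenNonempty (isolatedHull X))
    (hz : (isolatedHull X)ᶜ = ∅ ∨ ZeroDimensional ↥((isolatedHull X)ᶜ)) :
    AdmitsChainTransitiveHomeo X := by
  have hF : IsClosed (isolatedHull X) := isClosed_closure
  have hIF : isolatedPoints X ⊆ isolatedHull X :=
    subset_closure.trans (closure_isolatedPoints_subset_isolatedHull X)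
  have hzd : ∀ x ∉ isolatedHull X, ∀ r > 0,
      ∃ W, IsClopen W ∧ x ∈ W ∧ W ⊆ Metric.ball x r := by
    intro x hx r hr
    rcases hz with hz | hz
    · exact absurd (compl_empty_iff.1 hz ▸ mem_univ x) hx
    · exact exists_isClopen_subset_ball hF.isOpen_compl hz hx hr
  rcases (isolatedHull X).eq_empty_or_nonempty with he | hne
  · exact admitsChainTransitiveHomeo_of_zeroDim_perfect X (subset_empty_iff.1 (he ▸ hIF))
      fun x => hzd x (he ▸ notMem_empty x)
  have huniv : IsOpen (isolatedHull X) → isolatedHull X = univ := by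
    intro ho
    by_contra hu
    exact h ⟨hu, ⟨hF, ho⟩, hne⟩
  by_cases hI : IsClosed (isolatedPoints X)
  · have heq := isolatedHull_eq_of_isClosed hI
    have hIu : isolatedPoints X = univ := heq ▸ huniv (heq ▸ isOpen_isolatedPoints X)
    have : DiscreteTopology X := discreteTopology_iff_isOpen_singleton.2 fun x => by
      have : x ∈ isolatedPoints X := hIu ▸ mem_univ x
      exact this
    have : Finite X := finite_of_compact_of_discrete
    exact admitsChainTransitiveHomeo_of_discrete X
  · exact admitsChainTransitiveHomeo_of_not_isClosed_isolatedPoints hI huniv hzd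

theorem corollary3p12 (X : Type*) [MetricSpace X] [CompactSpace X] [Nonempty X] :
    (ProperClopenNonempty (isolatedHull X) →
      HomeoDecomposable X ∧ ¬ AdmitsChainTransitiveHomeo X) ∧
    (¬ ProperClopenNonempty (isolatedHull X) →
      ((isolatedHull X)ᶜ = ∅ ∨ ZeroDimensional ↥((isolatedHull X)ᶜ)) →
        AdmitsChainTransitiveHomeo X) ∧
    (Dense (isolatedPoints X) → AdmitsChainTransitiveHomeo X) := by
  refine ⟨fun h => ?_, admitsChainTransitiveHomeo_of_not_properClopenNonempty, fun h => ?_⟩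
  · have hd : HomeoDecomposable X := ⟨_, h, image_isolatedHull⟩
    exact ⟨hd, not_admitsChainTransitiveHomeo_of_homeoDecomposable hd⟩
  · have hu : isolatedHull X = univ :=
      univ_subset_iff.1 (h.closure_eq ▸ closure_isolatedPoints_subset_isolatedHull X)
    exact admitsChainTransitiveHomeo_of_not_properClopenNonempty (fun hp => hp.1 hu)
      (Or.inl (by rw [hu, compl_univ]))
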